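/- Let $X$ be a compact Hausdorff space and let $T:X\to X$ be a surjective local homeomorphism. Let $G=\{(x,k-l,y): x,y\in X,\ k,l\ge 0,\ T^kx=T^ly\}$ be the Deaconu–Renault groupoid of $T$, with composition $(x,n,y)(y,n',z)=(x,n+n',z)$, inverse $(x,n,y)^{-1}=(y,-n,x)$, and the topology with basis the sets $Z(U,V,k,l)=\{(x,k-l,y): x\in U,\ y\in V,\ T^kx=T^ly\}$, where $U,V\subseteq X$ are open, $T^k|_U$ and $T^l|_V$ are homeomorphisms onto their images, and $T^k(U)=T^l(V)$. Let $C_c(G)$ carry the product $(f*g)(x,n,y)=\sum_{(p,z)} f(x,p,z)\,g(z,n-p,y)$, the sum over all $(p,z)$ with $(x,p,z),(z,n-p,y)\in G$, and the involution $f^*(x,n,y)=\overline{f(y,-n,x)}$, and let $C^*(G)$ be its completion in the norm $\|f\|=\sup_\pi\|\pi(f)\|$, where $\pi$ ranges over the $*$-homomorphisms of $C_c(G)$ into the bounded operators on a Hilbert space that are continuous from the inductive limit topology to the weak operator topology. Let $R_{k,l}=\{(x,k-l,y)\in G: T^kx=T^ly\}$. Define $\iota:C(X)\to C^*(G)$ by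 $\iota(\varphi)(x,n,y)=\varphi(x)1_{R_{0,0}}(x,n,y)$, and let $S\in C_c(G)\subseteq C^*(G)$ be given by $S(x,1,Tx)=|T^{-1}(Tx)|^{-1/2}$ and $S=0$ off $R_{1,0}$. Let $\mathcal X$ be the Deaconu correspondence over $C(X)$: the completion of $C(X)$ (which is $C(X)$ itself) in the inner product $\langle\xi,\eta\rangle(x)=|T^{-1}(x)|^{-1}\sum_{Ty=x}\overline{\xi(y)}\eta(y)$, with the actions $(a\cdot\xi\cdot b)(x)=a(x)\xi(x)b(Tx)$. Put $\psi(\xi)=\iota(\xi)S$ for $\xi\in\mathcal X$, and $\beta(f)=f\circ T$ for $f\in C(X)$. Then the following hold in $C^*(G)$. 1. $\iota(\beta(a))S=S\iota(a)$ for all $a\in C(X)$. 2. If $\{m_1,\dots,m_n\}$ is a filter bank, i.e. an orthonormal basis of $\mathcal X$ ($\langle m_i,m_j\rangle=\delta_{ij}1$ and the $m_i$ generate $\mathcal X$ as a right $C(X)$-module), and $S_i=\psi(m_i)$, then $\{S_i\}$ is a Cuntz family of isometries, i.e. $S_i^*S_j=\delta_{ij}1$ and $\sum_{i=1}^n S_iS_i^*=1$,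 and $\iota(\beta(a))S_i=S_i\iota(a)$ for all $a\in C(X)$ and all $i$. 3. With $S_i$ as in 2, $\iota(\beta(a))=\sum_{i=1}^n S_i\iota(a)S_i^*$ for all $a\in C(X)$. -/

import Mathlib

open Topology Filter Set Function
open scoped CompactlySupported ComplexConjugate

universe u

/-- A surjective local homeomorphism of the space `X` onto itself. -/
structure SurjLocalHomeo (X : Type u) [TopologicalSpace X] where
  /-- the underlying map -/
  toFun : X → X
  isLocalHomeomorph : IsLocalHomeomorph toFun
  surjective : Surjective toFun

namespace SurjLocalHomeo

instance {X : Type u} [TopologicalSpace X] : CoeFun (SurjLocalHomeo X) fun _ => X → X :=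
  ⟨SurjLocalHomeo.toFun⟩

section

variable {X : Type u} [TopologicalSpace X] (T : SurjLocalHomeo X)

/-- `(x, n, y)` is an arrow of the Deaconu-Renault groupoid:
`T ^ k x = T ^ l y` and `n = k - l` for some natural numbers `k`, `l`. -/
def IsArrow (x : X) (n : ℤ) (y : X) : Prop :=
  ∃ k l : ℕ, T^[k] x = T^[l] y ∧ n = (k : ℤ) - l

/-- The Deaconu-Renault groupoid of `T`: the triples `(x, n, y)` in `X × ℤ × X` with
`T ^ k x = T ^ l y` and `n = k - l` for some `k`, `l`. The arrow `(x, n, y)` has range `x` and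
source `y`; composition is `(x, n, y) (y, m, z) = (x, n + m, z)` and the inverse of
`(x, n, y)` is `(y, -n, x)`. -/
@[ext] structure Gpd where
  /-- the range `x` of `(x, n, y)` -/
  r : X
  /-- the degree `n` of `(x, n, y)` -/
  d : ℤ
  /-- the source `y` of `(x, n, y)` -/
  s : X
  isArrow : T.IsArrow r d s

variable {T}

/-- The composition of two composable arrows of the groupoid. -/
def Gpd.comp (a b : T.Gpd) (h : a.s = b.r) : T.Gpd where
  r := a.r
  d := a.d + b.d
  s := b.s
  isArrow := by
    obtain ⟨k, l, h1, h2⟩ := a.isArrow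
    obtain ⟨k', l', h3, h4⟩ := b.isArrow
    refine ⟨k' + k, l + l', ?_, by push_cast; omega⟩
    rw [iterate_add_apply, h1, iterate_add_apply, ← h3, h, ← iterate_add_apply,
      ← iterate_add_apply, add_comm]

/-- The inverse of an arrow of the groupoid. -/
def Gpd.inv (a : T.Gpd) : T.Gpd where
  r := a.s
  d := -a.d
  s := a.r
  isArrow := by
    obtain ⟨k, l, h1, h2⟩ := a.isArrow
    exact ⟨l, k, h1.symm, by omega⟩

variable (T)

/-- The set `R_{k,l}` of the arrows `(x, k - l, y)` with `T ^ k x = T ^ l y`. -/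
def R (k l : ℕ) : Set T.Gpd := {a | T^[k] a.r = T^[l] a.s ∧ a.d = (k : ℤ) - l}

/-- The set `Z(U, V, k, l)` of the arrows `(x, k - l, y)` with `x ∈ U`, `y ∈ V` and
`T ^ k x = T ^ l y`. -/
def Z (U V : Set X) (k l : ℕ) : Set T.Gpd := {a | a.r ∈ U ∧ a.s ∈ V ∧ a ∈ T.R k l}

/-- The topology of the groupoid is generated by the sets `Z(U, V, k, l)`, where `U` and `V` are
open, `T ^ k` and `T ^ l` are injective on `U` and `V` respectively (hence, being open and
continuous, are homeomorphisms of `U` and `V` onto their images), and `T ^ k U = T ^ l V`. -/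
instance : TopologicalSpace T.Gpd :=
  TopologicalSpace.generateFrom {B | ∃ (U V : Set X) (k l : ℕ), IsOpen U ∧ IsOpen V ∧
    InjOn T^[k] U ∧ InjOn T^[l] V ∧ T^[k] '' U = T^[l] '' V ∧ B = T.Z U V k l}

lemma isLocalHomeomorph_iterate (k : ℕ) : IsLocalHomeomorph T^[k] := by
  induction k with
  | zero => exact (Homeomorph.refl X).isLocalHomeomorph
  | succ k ih => exact ih.comp T.isLocalHomeomorph

lemma continuous_iterate (k : ℕ) : Continuous T^[k] := (T.isLocalHomeomorph_iterate k).continuous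

/-- Basic neighbourhoods of an arrow can be found in any `R k l` that contains it. -/
lemma exists_basic {a : T.Gpd} {k l : ℕ} (ha : a ∈ T.R k l) {A C : Set X}
    (hA : A ∈ 𝓝 a.r) (hC : C ∈ 𝓝 a.s) :
    ∃ B ∈ 𝓝 a, B ⊆ T.R k l ∧ ∀ b ∈ B, b.r ∈ A ∧ b.s ∈ C := by
  obtain ⟨U, hU, haU, hUi⟩ := (T.isLocalHomeomorph_iterate k).isLocallyInjective a.r
  obtain ⟨V, hV, haV, hVi⟩ := (T.isLocalHomeomorph_iterate l).isLocallyInjective a.s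
  obtain ⟨A', hA', hAo, haA⟩ := mem_nhds_iff.1 hA
  obtain ⟨C', hC', hCo, haC⟩ := mem_nhds_iff.1 hC
  set W := T^[k] '' (U ∩ A') ∩ T^[l] '' (V ∩ C') with hW
  have hWo : IsOpen W := ((T.isLocalHomeomorph_iterate k).isOpenMap _ (hU.inter hAo)).inter
    ((T.isLocalHomeomorph_iterate l).isOpenMap _ (hV.inter hCo))
  refine ⟨T.Z (U ∩ A' ∩ T^[k] ⁻¹' W) (V ∩ C' ∩ T^[l] ⁻¹' W) k l, ?_, fun b hb => hb.2.2,
    fun b hb => ⟨hA' hb.1.1.2, hC' hb.2.1.1.2⟩⟩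
  refine IsOpen.mem_nhds ?_ ?_
  · refine TopologicalSpace.isOpen_generateFrom_of_mem ⟨_, _, k, l,
      (hU.inter hAo).inter (hWo.preimage (T.continuous_iterate k)),
      (hV.inter hCo).inter (hWo.preimage (T.continuous_iterate l)),
      hUi.mono fun x hx => hx.1.1, hVi.mono fun x hx => hx.1.1, ?_, rfl⟩
    rw [image_inter_preimage, image_inter_preimage]
    ext w
    simp only [hW, mem_inter_iff]
    tauto
  · have hw : T^[k] a.r ∈ W := ⟨⟨_, ⟨haU, haA⟩, rfl⟩, ⟨_, ⟨haV, haC⟩, ha.1.symm⟩⟩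
    refine ⟨⟨⟨haU, haA⟩, hw⟩, ⟨⟨haV, haC⟩, ?_⟩, ha⟩
    rw [mem_preimage, ← ha.1]
    exact hw

lemma exists_mem_R (a : T.Gpd) : ∃ k l, a ∈ T.R k l := a.isArrow

lemma isOpen_R (k l : ℕ) : IsOpen (T.R k l) := by
  rw [isOpen_iff_mem_nhds]
  intro a ha
  obtain ⟨B, hB, h, -⟩ := T.exists_basic ha univ_mem univ_mem
  exact mem_of_superset hB h

lemma continuous_r : Continuous (Gpd.r (T := T)) := by
  rw [continuous_iff_continuousAt]
  intro a A hA
  obtain ⟨k, l, ha⟩ := T.exists_mem_R a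
  obtain ⟨B, hB, -, h⟩ := T.exists_basic ha hA univ_mem
  exact mem_of_superset (x := B) hB fun b hb => (h b hb).1

lemma continuous_s : Continuous (Gpd.s (T := T)) := by
  rw [continuous_iff_continuousAt]
  intro a A hA
  obtain ⟨k, l, ha⟩ := T.exists_mem_R a
  obtain ⟨B, hB, -, h⟩ := T.exists_basic ha univ_mem hA
  exact mem_of_superset (x := B) hB fun b hb => (h b hb).2

lemma continuous_d : Continuous (Gpd.d (T := T)) := by
  rw [continuous_iff_continuousAt]
  intro a
  obtain ⟨k, l, ha⟩ := T.exists_mem_R a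
  refine tendsto_nhds_of_eventually_eq ?_
  filter_upwards [(T.isOpen_R k l).mem_nhds ha] with b hb
  rw [hb.2, ha.2]

instance [T2Space X] : T2Space T.Gpd :=
  T2Space.of_injective_continuous (f := fun a : T.Gpd => (a.r, a.d, a.s))
    (fun a b h => by
      simp only [Prod.mk.injEq] at h
      exact Gpd.ext h.1 h.2.1 h.2.2)
    (T.continuous_r.prodMk (T.continuous_d.prodMk T.continuous_s))

/-- A map into the groupoid which stays in `R k l` is continuous if its two components are. -/
lemma tendsto_of_mem_R {Y : Type*} {F : Filter Y} {h : Y → T.Gpd} {a : T.Gpd} {k l : ℕ}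
    (ha : a ∈ T.R k l) (hR : ∀ᶠ y in F, h y ∈ T.R k l)
    (hr : Tendsto (fun y => (h y).r) F (𝓝 a.r)) (hs : Tendsto (fun y => (h y).s) F (𝓝 a.s)) :
    Tendsto h F (𝓝 a) := by
  rw [TopologicalSpace.tendsto_nhds_generateFrom_iff]
  rintro _ ⟨U, V, k', l', hU, hV, -, -, -, rfl⟩ haZ
  obtain ⟨haU, haV, ha'⟩ := haZ
  have key : ∀ᶠ y in F, T^[k'] (h y).r = T^[l'] (h y).s := by
    rcases le_total k k' with hk | hk
    · obtain ⟨e, rfl⟩ := Nat.exists_eq_add_of_le hk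
      have hl : l' = e + l := by have := ha.2; have := ha'.2; push_cast at *; omega
      filter_upwards [hR] with y hy
      rw [hl, add_comm k, iterate_add_apply, iterate_add_apply, hy.1]
    · obtain ⟨e, rfl⟩ := Nat.exists_eq_add_of_le hk
      have hl : l = e + l' := by have := ha.2; have := ha'.2; push_cast at *; omega
      subst hl
      obtain ⟨W, hW, haW, hWi⟩ := (T.isLocalHomeomorph_iterate e).isLocallyInjective (T^[k'] a.r)
      have h1 := ((T.continuous_iterate k').tendsto a.r).comp hr
      have h2 := ((T.continuous_iterate l').tendsto a.s).comp hs
      rw [← ha'.1] at h2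
      filter_upwards [hR, h1 (hW.mem_nhds haW), h2 (hW.mem_nhds haW)] with y hy hy1 hy2
      refine hWi hy1 hy2 ?_
      have := hy.1
      rwa [add_comm k', iterate_add_apply, iterate_add_apply] at this
  filter_upwards [hR, key, hr (hU.mem_nhds haU), hs (hV.mem_nhds haV)] with y hy hk h1 h2
  exact ⟨h1, h2, hk, by rw [hy.2, ← ha.2, ha'.2]⟩

/-- Local sections of an iterate of `T`. -/
lemma exists_section_iterate (l : ℕ) (z : X) : ∃ τ : X → X, ContinuousAt τ (T^[l] z) ∧
    τ (T^[l] z) = z ∧ (∀ᶠ w in 𝓝 (T^[l] z), T^[l] (τ w) = w) ∧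
    ∀ᶠ z' in 𝓝 z, τ (T^[l] z') = z' := by
  have h := T.isLocalHomeomorph_iterate l
  set e := h.localInverseAt z with he
  have hz : T^[l] z ∈ e.source := h.apply_self_mem_localInverseAt_source
  refine ⟨e, e.continuousAt hz, h.localInverseAt_apply_self, ?_, ?_⟩
  · filter_upwards [e.open_source.mem_nhds hz] with w hw
    exact h.apply_localInverseAt_of_mem hw
  · filter_upwards [e.open_target.mem_nhds h.self_mem_localInverseAt_target] with z' hz'
    have := e.right_inv hz'
    rwa [he, h.localInverseAt_symm] at this

/-- Local sections of the range map. -/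
lemma exists_section_r (a : T.Gpd) : ∃ σ : X → T.Gpd, ContinuousAt σ a.r ∧ σ a.r = a ∧
    (∀ᶠ x in 𝓝 a.r, (σ x).r = x) ∧ ∀ᶠ b in 𝓝 a, σ b.r = b := by
  classical
  obtain ⟨k, l, ha⟩ := T.exists_mem_R a
  obtain ⟨τ, h1, h2, h3, h4⟩ := T.exists_section_iterate l a.s
  rw [← ha.1] at h1 h2 h3
  let σ : X → T.Gpd := fun x => if h : T^[k] x = T^[l] (τ (T^[k] x)) then
    ⟨x, a.d, τ (T^[k] x), k, l, h, ha.2⟩ else a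
  have hk := (T.continuous_iterate k).tendsto a.r
  have hev : ∀ᶠ x in 𝓝 a.r, T^[k] x = T^[l] (τ (T^[k] x)) := by
    filter_upwards [hk.eventually h3] with x hx using hx.symm
  have hσ : ∀ᶠ x in 𝓝 a.r, σ x ∈ T.R k l ∧ (σ x).r = x ∧ (σ x).s = τ (T^[k] x) := by
    filter_upwards [hev] with x hx
    simp only [σ, dif_pos hx]
    exact ⟨⟨hx, ha.2⟩, trivial, trivial⟩
  have hσa : σ a.r = a := by
    have := hev.self_of_nhds
    simp only [σ, dif_pos this]
    exact Gpd.ext rfl rfl h2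
  refine ⟨σ, ?_, hσa, hσ.mono fun x hx => hx.2.1, ?_⟩
  · rw [ContinuousAt, hσa]
    refine T.tendsto_of_mem_R ha (hσ.mono fun x hx => hx.1) ?_ ?_
    · exact tendsto_id.congr' (hσ.mono fun x hx => hx.2.1.symm)
    · have : Tendsto (fun x => τ (T^[k] x)) (𝓝 a.r) (𝓝 a.s) := by
        have := h1.tendsto.comp hk
        rwa [h2] at this
      exact this.congr' (hσ.mono fun x hx => hx.2.2.symm)
  · filter_upwards [(T.isOpen_R k l).mem_nhds ha, (T.continuous_s.tendsto a).eventually h4,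
      (T.continuous_r.tendsto a).eventually hσ] with b hb hb4 hbσ
    have e2 : (σ b.r).s = b.s := by rw [hbσ.2.2, hb.1, hb4]
    exact Gpd.ext hbσ.2.1 (by rw [hbσ.1.2, hb.2]) e2

end

/-- Over a neighbourhood of a point, the part of a local homeomorphism that meets a compact set is
covered by finitely many disjoint sections. -/
lemma exists_finite_sections {E B : Type*} [TopologicalSpace E] [TopologicalSpace B] [T2Space E]
    [T2Space B] {q : E → B} (hq : Continuous q) {K : Set E} (hK : IsCompact K) (b₀ : B)
    (hsec : ∀ e, q e = b₀ → ∃ σ : B → E, ContinuousAt σ b₀ ∧ σ b₀ = e ∧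
      (∀ᶠ b in 𝓝 b₀, q (σ b) = b) ∧ ∀ᶠ e' in 𝓝 e, σ (q e') = e') :
    ∃ (F : Finset E) (σ : E → B → E),
      (∀ e ∈ F, q e = b₀ ∧ ContinuousAt (σ e) b₀ ∧ σ e b₀ = e) ∧
      ∀ᶠ b in 𝓝 b₀, (∀ e ∈ F, q (σ e b) = b) ∧ InjOn (fun e => σ e b) F ∧
        ∀ e' ∈ K, q e' = b → ∃ e ∈ F, σ e b = e' := by
  classical
  have hsec' : ∀ e, ∃ σ : B → E, q e = b₀ → ContinuousAt σ b₀ ∧ σ b₀ = e ∧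
      (∀ᶠ b in 𝓝 b₀, q (σ b) = b) ∧ ∀ᶠ e' in 𝓝 e, σ (q e') = e' := fun e => by
    by_cases he : q e = b₀
    · exact (hsec e he).imp fun σ h _ => h
    · exact ⟨fun _ => e, fun h => absurd h he⟩
  choose σ hσ using hsec'
  have hfc : IsCompact (K ∩ q ⁻¹' {b₀}) := hK.inter_right (isClosed_singleton.preimage hq)
  obtain ⟨F, hF, hFc⟩ := hfc.elim_nhds_subcover_nhdsSet (U := fun e => {e' | σ e (q e') = e'})
    (fun e he => (hσ e he.2).2.2.2)
  have hF' : ∀ e ∈ F, q e = b₀ := fun e he => (hF e he).2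
  refine ⟨F, σ, fun e he => ⟨hF' e he, (hσ e (hF' e he)).1, (hσ e (hF' e he)).2.1⟩, ?_⟩
  have e1 : ∀ᶠ b in 𝓝 b₀, ∀ e ∈ F, q (σ e b) = b :=
    (Filter.eventually_all_finset F).2 fun e he => (hσ e (hF' e he)).2.2.1
  have e2 : ∀ᶠ b in 𝓝 b₀, ∀ e ∈ F, ∀ e' ∈ F, e ≠ e' → σ e b ≠ σ e' b := by
    refine (Filter.eventually_all_finset F).2 fun e he =>
      (Filter.eventually_all_finset F).2 fun e' he' => ?_
    by_cases hne : e = e'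
    · exact Filter.Eventually.of_forall fun b h => absurd hne h
    have t1 := (hσ e (hF' e he)).1.tendsto
    have t2 := (hσ e' (hF' e' he')).1.tendsto
    rw [(hσ e (hF' e he)).2.1] at t1
    rw [(hσ e' (hF' e' he')).2.1] at t2
    obtain ⟨O, O', hO, hO', heO, heO', hd⟩ := t2_separation hne
    filter_upwards [t1 (hO.mem_nhds heO), t2 (hO'.mem_nhds heO')] with b hb hb' _
    exact hd.ne_of_mem hb hb'
  obtain ⟨O, hO, hfO, hOF⟩ := mem_nhdsSet_iff_exists.1 hFc
  have e3 : ∀ᶠ b in 𝓝 b₀, b ∉ q '' (K \ O) := by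
    refine ((hK.diff hO).image hq).isClosed.isOpen_compl.mem_nhds ?_
    rintro ⟨e, ⟨heK, heO⟩, he⟩
    exact heO (hfO ⟨heK, he⟩)
  filter_upwards [e1, e2, e3] with b h1 h2 h3
  refine ⟨h1, fun e he e' he' hee => by_contra fun hne => h2 e he e' he' hne hee,
    fun e' he' hb => ?_⟩
  have : e' ∈ O := by_contra fun h => h3 ⟨e', ⟨he', h⟩, hb⟩
  obtain ⟨e, he, hee⟩ := mem_iUnion₂.1 (hOF this)
  subst hb
  exact ⟨e, he, hee⟩

/-- The convolution algebra `C_c(G)` of the Deaconu-Renault groupoid `G` of `T`: as a vector space,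
the continuous compactly supported complex functions on `G`. -/
def ConvAlg {X : Type u} [TopologicalSpace X] (T : SurjLocalHomeo X) : Type u := C_c(T.Gpd, ℂ)

section

variable {X : Type u} [TopologicalSpace X] {T : SurjLocalHomeo X}

noncomputable instance : AddCommGroup T.ConvAlg := inferInstanceAs (AddCommGroup C_c(T.Gpd, ℂ))

noncomputable instance : Module ℂ T.ConvAlg := inferInstanceAs (Module ℂ C_c(T.Gpd, ℂ))

instance : FunLike T.ConvAlg T.Gpd ℂ := inferInstanceAs (FunLike C_c(T.Gpd, ℂ) T.Gpd ℂ)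

namespace ConvAlg

open Classical in
/-- The value of `f ∈ C_c(G)` at `(x, n, y) ∈ X × ℤ × X`, where `f` is extended by `0` to the
triples that are not in `G`. -/
noncomputable def val (f : T.ConvAlg) (x : X) (n : ℤ) (y : X) : ℂ :=
  if h : T.IsArrow x n y then f ⟨x, n, y, h⟩ else 0

lemma val_apply (f : T.ConvAlg) (a : T.Gpd) : f.val a.r a.d a.s = f a := by
  rw [val, dif_pos a.isArrow]

lemma val_of_not (f : T.ConvAlg) {x : X} {n : ℤ} {y : X} (h : ¬ T.IsArrow x n y) :
    f.val x n y = 0 := by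
  rw [val, dif_neg h]

lemma ext_val {f g : T.ConvAlg} (h : ∀ x n y, T.IsArrow x n y → f.val x n y = g.val x n y) :
    f = g :=
  DFunLike.ext _ _ fun a => by rw [← val_apply, ← val_apply, h _ _ _ a.isArrow]

lemma val_add (f g : T.ConvAlg) (x : X) (n : ℤ) (y : X) :
    (f + g).val x n y = f.val x n y + g.val x n y := by
  unfold val
  split_ifs
  · rfl
  · simp

lemma val_smul (c : ℂ) (f : T.ConvAlg) (x : X) (n : ℤ) (y : X) :
    (c • f).val x n y = c * f.val x n y := by
  unfold val
  split_ifs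
  · rfl
  · simp

lemma val_zero (x : X) (n : ℤ) (y : X) : (0 : T.ConvAlg).val x n y = 0 := by
  unfold val
  split_ifs <;> rfl

lemma continuousAt_val (f : T.ConvAlg) {Y : Type*} [TopologicalSpace Y] {a c : Y → X} {d : Y → ℤ}
    {y₀ : Y} (ha : ContinuousAt a y₀) (hc : ContinuousAt c y₀) (k l : ℕ)
    (h : ∀ᶠ y in 𝓝 y₀, T^[k] (a y) = T^[l] (c y) ∧ d y = (k : ℤ) - l) :
    ContinuousAt (fun y => f.val (a y) (d y) (c y)) y₀ := by
  classical
  obtain ⟨h1, h2⟩ := h.self_of_nhds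
  let γ₀ : T.Gpd := ⟨a y₀, d y₀, c y₀, k, l, h1, h2⟩
  let γ : Y → T.Gpd := fun y => if h : T^[k] (a y) = T^[l] (c y) ∧ d y = (k : ℤ) - l then
    ⟨a y, d y, c y, k, l, h⟩ else γ₀
  have hγ : ∀ᶠ y in 𝓝 y₀, γ y ∈ T.R k l ∧ (γ y).r = a y ∧ (γ y).d = d y ∧ (γ y).s = c y := by
    filter_upwards [h] with y hy
    simp only [γ, dif_pos hy]
    exact ⟨hy, trivial, trivial, trivial⟩
  have ht : Tendsto γ (𝓝 y₀) (𝓝 γ₀) := by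
    refine T.tendsto_of_mem_R (k := k) (l := l) ⟨h1, h2⟩ (hγ.mono fun y hy => hy.1) ?_ ?_
    · exact Tendsto.congr' (hγ.mono fun y hy => hy.2.1.symm) ha
    · exact Tendsto.congr' (hγ.mono fun y hy => hy.2.2.2.symm) hc
  have hf : Continuous (f : T.Gpd → ℂ) := f.continuous_toFun
  have := (hf.tendsto γ₀).comp ht
  rw [ContinuousAt, show f.val (a y₀) (d y₀) (c y₀) = f γ₀ from f.val_apply γ₀]
  refine this.congr' (hγ.mono fun y hy => ?_)
  rw [comp_apply, ← val_apply, hy.2.1, hy.2.2.1, hy.2.2.2]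

/-- The convolution product of `C_c(G)`:
`(f * g)(x, n, y) = ∑ f(x, p, z) g(z, n - p, y)`, the (finite) sum over all `(p, z)`. -/
noncomputable def conv (f g : T.ConvAlg) (x : X) (n : ℤ) (y : X) : ℂ :=
  ∑ᶠ a : ℤ × X, f.val x a.1 a.2 * g.val a.2 (n - a.1) y

lemma isArrow_comp {x y z : X} {n m : ℤ} (h : T.IsArrow x n y) (h' : T.IsArrow y m z) :
    T.IsArrow x (n + m) z := (Gpd.comp ⟨x, n, y, h⟩ ⟨y, m, z, h'⟩ rfl).isArrow

lemma conv_ne_zero {f g : T.ConvAlg} {x : X} {n : ℤ} {y : X} (h : f.conv g x n y ≠ 0) :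
    ∃ p z, f.val x p z ≠ 0 ∧ g.val z (n - p) y ≠ 0 := by
  by_contra! hc
  refine h (finsum_eq_zero_of_forall_eq_zero fun a => ?_)
  by_cases h0 : f.val x a.1 a.2 = 0
  · rw [h0, zero_mul]
  · rw [hc _ _ h0, mul_zero]

end ConvAlg

variable (T)

/-- The arrows that lie in some `R k l` with `k, l ≤ N`. -/
def bddSet (N : ℕ) : Set T.Gpd := {a | ∃ k ≤ N, ∃ l ≤ N, a ∈ T.R k l}

lemma bddSet_eq (N : ℕ) :
    T.bddSet N = ⋃ p ∈ Finset.range (N + 1) ×ˢ Finset.range (N + 1), T.R p.1 p.2 := by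
  ext a
  simp only [bddSet, mem_ofPred_eq, mem_iUnion, Finset.mem_product, Finset.mem_range,
    Nat.lt_succ_iff, exists_prop, Prod.exists]
  constructor
  · rintro ⟨k, hk, l, hl, h⟩
    exact ⟨k, l, ⟨hk, hl⟩, h⟩
  · rintro ⟨k, l, ⟨hk, hl⟩, h⟩
    exact ⟨k, hk, l, hl, h⟩

lemma isOpen_bddSet (N : ℕ) : IsOpen (T.bddSet N) := by
  rw [bddSet_eq]
  exact isOpen_biUnion fun p _ => T.isOpen_R _ _

variable {T} in
lemma mem_R_zero (a : T.Gpd) : a ∈ T.R 0 0 ↔ a.d = 0 ∧ a.r = a.s := by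
  simp [R, and_comm]

variable {T} in
lemma isArrow_refl (x : X) : T.IsArrow x 0 x := ⟨0, 0, rfl, by simp⟩

variable [CompactSpace X] [T2Space X]

lemma isCompact_R (k l : ℕ) : IsCompact (T.R k l) := by
  let Y := {p : X × X // T^[k] p.1 = T^[l] p.2}
  have hY : IsClosed {p : X × X | T^[k] p.1 = T^[l] p.2} :=
    isClosed_eq ((T.continuous_iterate k).comp continuous_fst)
      ((T.continuous_iterate l).comp continuous_snd)
  have : CompactSpace Y := isCompact_iff_compactSpace.1 hY.isCompact
  let g : Y → T.Gpd := fun p => ⟨p.1.1, (k : ℤ) - l, p.1.2, k, l, p.2, rfl⟩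
  have hg : Continuous g := continuous_iff_continuousAt.2 fun p =>
    T.tendsto_of_mem_R (k := k) (l := l) ⟨p.2, rfl⟩ (Eventually.of_forall fun p => ⟨p.2, rfl⟩)
      (continuous_fst.comp continuous_subtype_val).continuousAt
      (continuous_snd.comp continuous_subtype_val).continuousAt
  convert isCompact_range hg
  ext a
  constructor
  · rintro ⟨h1, h2⟩
    exact ⟨⟨(a.r, a.s), h1⟩, Gpd.ext rfl h2.symm rfl⟩
  · rintro ⟨p, rfl⟩
    exact ⟨p.2, rfl⟩

lemma isCompact_bddSet (N : ℕ) : IsCompact (T.bddSet N) := by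
  rw [bddSet_eq]
  exact Finset.isCompact_biUnion _ fun p _ => T.isCompact_R _ _

variable {T}

namespace ConvAlg

/-- A continuous function that vanishes off some `bddSet N` is in `C_c(G)`. -/
def mk (g : T.Gpd → ℂ) (hg : Continuous g) (N : ℕ) (h : ∀ a, g a ≠ 0 → a ∈ T.bddSet N) :
    T.ConvAlg where
  toFun := g
  continuous_toFun := hg
  hasCompactSupport' := HasCompactSupport.intro (T.isCompact_bddSet N) fun a ha => by
    by_contra h0
    exact ha (h a h0)

@[simp] lemma mk_apply (g : T.Gpd → ℂ) (hg : Continuous g) (N : ℕ)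
    (h : ∀ a, g a ≠ 0 → a ∈ T.bddSet N) (a : T.Gpd) : mk g hg N h a = g a := rfl

lemma exists_bdd (f : T.ConvAlg) : ∃ N, ∀ a, f a ≠ 0 → a ∈ T.bddSet N := by
  have hc : IsCompact (tsupport (f : T.Gpd → ℂ)) := f.hasCompactSupport'
  obtain ⟨N, hN⟩ := hc.elim_directed_cover T.bddSet T.isOpen_bddSet
    (fun a _ => by
      obtain ⟨k, l, h⟩ := T.exists_mem_R a
      exact mem_iUnion.2 ⟨max k l, k, le_max_left _ _, l, le_max_right _ _, h⟩)
    (Monotone.directed_le fun N M hNM a => by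
      rintro ⟨k, hk, l, hl, h⟩
      exact ⟨k, hk.trans hNM, l, hl.trans hNM, h⟩)
  exact ⟨N, fun a ha => hN (subset_tsupport _ ha)⟩

lemma exists_bdd_val (f : T.ConvAlg) : ∃ N : ℕ, ∀ x n y, f.val x n y ≠ 0 →
    ∃ k ≤ N, ∃ l ≤ N, T^[k] x = T^[l] y ∧ n = (k : ℤ) - l := by
  obtain ⟨N, hN⟩ := f.exists_bdd
  refine ⟨N, fun x n y h => ?_⟩
  by_cases hA : T.IsArrow x n y
  · rw [val, dif_pos hA] at h
    exact hN _ h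
  · exact absurd (f.val_of_not hA) h

lemma exists_sum_formula (f : T.ConvAlg) (x₀ : X) :
    ∃ (F : Finset T.Gpd) (σ : T.Gpd → X → T.Gpd),
      (∀ e ∈ F, e.r = x₀ ∧ ContinuousAt (σ e) x₀ ∧ σ e x₀ = e) ∧
      ∀ᶠ x in 𝓝 x₀, (∀ e ∈ F, (σ e x).r = x) ∧
        {a : ℤ × X | f.val x a.1 a.2 ≠ 0}.Finite ∧
        ∀ h : ℤ → X → ℂ, ∑ᶠ a : ℤ × X, f.val x a.1 a.2 * h a.1 a.2 =
          ∑ e ∈ F, f (σ e x) * h (σ e x).d (σ e x).s := by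
  classical
  obtain ⟨F, σ, hF, hev⟩ := exists_finite_sections T.continuous_r
    (K := tsupport (f : T.Gpd → ℂ)) f.hasCompactSupport' x₀
    (fun a ha => by
      subst ha
      exact T.exists_section_r a)
  refine ⟨F, σ, hF, hev.mono fun x ⟨h1, h2, h3⟩ => ?_⟩
  have hsub : {a : ℤ × X | f.val x a.1 a.2 ≠ 0} ⊆
      (F.image fun e => ((σ e x).d, (σ e x).s) : Finset (ℤ × X)) := by
    rintro ⟨n, y⟩ ha
    by_cases hA : T.IsArrow x n y
    · rw [mem_ofPred_eq, val, dif_pos hA] at ha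
      obtain ⟨e, he, hee⟩ := h3 ⟨x, n, y, hA⟩ (subset_tsupport _ ha) rfl
      refine Finset.mem_coe.2 (Finset.mem_image.2 ⟨e, he, ?_⟩)
      rw [hee]
    · exact absurd (f.val_of_not hA) ha
  refine ⟨h1, (Finset.finite_toSet _).subset hsub, fun h => ?_⟩
  rw [finsum_eq_sum_of_support_subset _ (s := F.image fun e => ((σ e x).d, (σ e x).s)),
    Finset.sum_image]
  · refine Finset.sum_congr rfl fun e he => ?_
    have := f.val_apply (σ e x)
    rw [h1 e he] at this
    rw [this]
  · intro e he e' he' hee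
    refine h2 he he' (Gpd.ext ((h1 e he).trans (h1 e' he').symm) ?_ ?_)
    · exact (Prod.mk.inj hee).1
    · exact (Prod.mk.inj hee).2
  · exact fun a ha => hsub fun h0 => ha (by simp only [h0, zero_mul])

lemma finite_val (f : T.ConvAlg) (x : X) : {a : ℤ × X | f.val x a.1 a.2 ≠ 0}.Finite := by
  obtain ⟨F, σ, -, h⟩ := f.exists_sum_formula x
  exact h.self_of_nhds.2.1

lemma continuous_conv (f g : T.ConvAlg) :
    Continuous fun a : T.Gpd => f.conv g a.r a.d a.s := by
  rw [continuous_iff_continuousAt]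
  intro a₀
  obtain ⟨F, σ, hF, hev⟩ := f.exists_sum_formula a₀.r
  have hev' := (T.continuous_r.tendsto a₀).eventually hev
  have key : ContinuousAt (fun a : T.Gpd => ∑ e ∈ F,
      f (σ e a.r) * g.val (σ e a.r).s (a.d - (σ e a.r).d) a.s) a₀ := by
    refine tendsto_finsetSum _ fun e he => ?_
    obtain ⟨her, hec, hee⟩ := hF e he
    have hσ : ContinuousAt (fun a : T.Gpd => σ e a.r) a₀ :=
      ContinuousAt.comp (f := Gpd.r) (g := σ e) hec T.continuous_r.continuousAt
    have hf : Continuous (f : T.Gpd → ℂ) := f.continuous_toFun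
    refine Tendsto.mul ((hf.tendsto _).comp hσ) ?_
    obtain ⟨k, l, hk⟩ := T.exists_mem_R a₀
    obtain ⟨k', l', hk'⟩ := T.exists_mem_R e
    have hσR : ∀ᶠ a in 𝓝 a₀, σ e a.r ∈ T.R k' l' := by
      refine hσ.eventually ((T.isOpen_R k' l').mem_nhds ?_)
      simpa only [hee] using hk'
    refine continuousAt_val g (T.continuous_s.continuousAt.comp hσ) T.continuous_s.continuousAt
      (k + l') (l + k') ?_
    filter_upwards [hσR, (T.isOpen_R k l).mem_nhds hk, hev'] with a ha hak har
    have hr := har.1 e he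
    refine ⟨?_, ?_⟩
    · rw [iterate_add_apply, ← ha.1, hr, ← iterate_add_apply, add_comm k,
        iterate_add_apply, hak.1, ← iterate_add_apply, add_comm]
    · rw [ha.2, hak.2]
      push_cast
      ring
  refine key.congr ?_
  filter_upwards [hev'] with a ha
  exact (ha.2.2 fun p z => g.val z (a.d - p) a.s).symm

noncomputable instance : Mul T.ConvAlg where
  mul f g := mk (fun a => f.conv g a.r a.d a.s) (f.continuous_conv g)
    (f.exists_bdd_val.choose + g.exists_bdd_val.choose) fun a ha => by
      obtain ⟨p, z, h1, h2⟩ := conv_ne_zero ha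
      obtain ⟨k, hk, l, hl, e1, e2⟩ := f.exists_bdd_val.choose_spec _ _ _ h1
      obtain ⟨k', hk', l', hl', e3, e4⟩ := g.exists_bdd_val.choose_spec _ _ _ h2
      refine ⟨k' + k, by omega, l + l', by omega, ?_, by push_cast; omega⟩
      rw [iterate_add_apply, e1, iterate_add_apply, ← e3, ← iterate_add_apply,
        ← iterate_add_apply, add_comm]

lemma mul_apply (f g : T.ConvAlg) (a : T.Gpd) :
    (f * g) a = ∑ᶠ b : ℤ × X, f.val a.r b.1 b.2 * g.val b.2 (a.d - b.1) a.s := rfl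

lemma val_mul (f g : T.ConvAlg) (x : X) (n : ℤ) (y : X) : (f * g).val x n y =
    ∑ᶠ b : ℤ × X, f.val x b.1 b.2 * g.val b.2 (n - b.1) y := by
  by_cases hA : T.IsArrow x n y
  · rw [val, dif_pos hA, mul_apply]
  · rw [val, dif_neg hA]
    by_contra h
    obtain ⟨p, z, h1, h2⟩ := conv_ne_zero (Ne.symm h)
    refine hA ?_
    have h1' : T.IsArrow x p z := by_contra fun h => h1 (f.val_of_not h)
    have h2' : T.IsArrow z (n - p) y := by_contra fun h => h2 (g.val_of_not h)
    simpa using isArrow_comp h1' h2'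

lemma val_mul_eq_sum (f g : T.ConvAlg) (x : X) (n : ℤ) (y : X) {s : Finset (ℤ × X)}
    (hs : ∀ a : ℤ × X, f.val x a.1 a.2 ≠ 0 → g.val a.2 (n - a.1) y ≠ 0 → a ∈ s) :
    (f * g).val x n y = ∑ b ∈ s, f.val x b.1 b.2 * g.val b.2 (n - b.1) y := by
  rw [val_mul]
  refine finsum_eq_sum_of_support_subset _ fun a ha => ?_
  exact hs a (left_ne_zero_of_mul ha) (right_ne_zero_of_mul ha)

protected lemma mul_assoc (f g h : T.ConvAlg) : f * g * h = f * (g * h) := by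
  classical
  refine ext_val fun x n y _ => ?_
  set A : Finset (ℤ × X) := (f.finite_val x).toFinset with hA
  have hA' : ∀ a : ℤ × X, a ∈ A ↔ f.val x a.1 a.2 ≠ 0 := fun a => by simp [hA]
  let B : Finset (ℤ × X) := A.biUnion fun a =>
    ((g.finite_val a.2).toFinset).image fun b => (b.1 + a.1, b.2)
  have hB : ∀ a b : ℤ × X, f.val x a.1 a.2 ≠ 0 → g.val a.2 (b.1 - a.1) b.2 ≠ 0 → b ∈ B := by
    intro a b ha hb
    refine Finset.mem_biUnion.2 ⟨a, (hA' a).2 ha, Finset.mem_image.2 ⟨(b.1 - a.1, b.2), ?_, ?_⟩⟩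
    · simpa using hb
    · simp
  have hfg : ∀ b : ℤ × X, (f * g).val x b.1 b.2 =
      ∑ a ∈ A, f.val x a.1 a.2 * g.val a.2 (b.1 - a.1) b.2 := fun b =>
    val_mul_eq_sum f g x b.1 b.2 fun a ha _ => (hA' a).2 ha
  rw [val_mul_eq_sum (f * g) h x n y (s := B), val_mul_eq_sum f (g * h) x n y (s := A)]
  · simp_rw [hfg, Finset.sum_mul]
    rw [Finset.sum_comm]
    refine Finset.sum_congr rfl fun a ha => ?_
    rw [val_mul, ← finsum_comp_equiv ((Equiv.subRight a.1).prodCongr (Equiv.refl X)),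
      finsum_eq_sum_of_support_subset (s := B), Finset.mul_sum]
    · refine Finset.sum_congr rfl fun b _ => ?_
      simp [mul_assoc]
    · intro b hb
      refine hB a b ((hA' a).1 ha) ?_
      simpa using left_ne_zero_of_mul hb
  · exact fun a ha _ => (hA' a).2 ha
  · intro b hb _
    rw [hfg] at hb
    obtain ⟨a, -, ha⟩ := Finset.exists_ne_zero_of_sum_ne_zero hb
    exact hB a b (left_ne_zero_of_mul ha) (right_ne_zero_of_mul ha)

protected lemma mul_add (f g h : T.ConvAlg) : f * (g + h) = f * g + f * h := by
  refine ext_val fun x n y _ => ?_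
  have hs : ∀ a : ℤ × X, f.val x a.1 a.2 ≠ 0 → a ∈ (f.finite_val x).toFinset := fun a ha => by
    simpa using ha
  rw [val_add, val_mul_eq_sum f _ x n y fun a ha _ => hs a ha,
    val_mul_eq_sum f _ x n y fun a ha _ => hs a ha,
    val_mul_eq_sum f _ x n y fun a ha _ => hs a ha, ← Finset.sum_add_distrib]
  exact Finset.sum_congr rfl fun a _ => by rw [val_add, mul_add]

protected lemma add_mul (f g h : T.ConvAlg) : (f + g) * h = f * h + g * h := by
  classical
  refine ext_val fun x n y _ => ?_
  let s := (f.finite_val x).toFinset ∪ (g.finite_val x).toFinset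
  have hf : ∀ a : ℤ × X, f.val x a.1 a.2 ≠ 0 → a ∈ s := fun a ha =>
    Finset.mem_union_left _ (by simpa using ha)
  have hg : ∀ a : ℤ × X, g.val x a.1 a.2 ≠ 0 → a ∈ s := fun a ha =>
    Finset.mem_union_right _ (by simpa using ha)
  rw [val_add, val_mul_eq_sum f _ x n y fun a ha _ => hf a ha,
    val_mul_eq_sum g _ x n y fun a ha _ => hg a ha,
    val_mul_eq_sum (f + g) _ x n y (s := s), ← Finset.sum_add_distrib]
  · exact Finset.sum_congr rfl fun a _ => by rw [val_add, add_mul]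
  · intro a ha _
    by_contra h
    rw [val_add, not_ne_iff.1 (mt (hf a) h), not_ne_iff.1 (mt (hg a) h), add_zero] at ha
    exact ha rfl

protected lemma smul_mul (c : ℂ) (f g : T.ConvAlg) : c • f * g = c • (f * g) := by
  refine ext_val fun x n y _ => ?_
  rw [val_smul, val_mul, val_mul, mul_finsum]
  exact finsum_congr fun a => by rw [val_smul, mul_assoc]

protected lemma mul_smul (c : ℂ) (f g : T.ConvAlg) : f * c • g = c • (f * g) := by
  refine ext_val fun x n y _ => ?_
  rw [val_smul, val_mul, val_mul, mul_finsum]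
  exact finsum_congr fun a => by rw [val_smul, mul_left_comm]

/-- The involution of `C_c(G)`: `f⋆(x, n, y)` is the complex conjugate of `f(y, -n, x)`. -/
noncomputable instance : Star T.ConvAlg where
  star f := mk (fun a => conj (f a.inv))
    (by
      have hf : Continuous (f : T.Gpd → ℂ) := f.continuous_toFun
      refine Complex.continuous_conj.comp (hf.comp (continuous_iff_continuousAt.2 fun a => ?_))
      obtain ⟨k, l, hk⟩ := T.exists_mem_R a
      have h : ∀ b ∈ T.R k l, b.inv ∈ T.R l k := fun b hb =>
        ⟨hb.1.symm, by have := hb.2; simp only [Gpd.inv]; omega⟩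
      refine T.tendsto_of_mem_R (h a hk) ?_ (T.continuous_s.tendsto a) (T.continuous_r.tendsto a)
      filter_upwards [(T.isOpen_R k l).mem_nhds hk] with b hb using h b hb)
    f.exists_bdd.choose
    (fun a ha => by
      obtain ⟨k, hk, l, hl, h1, h2⟩ := f.exists_bdd.choose_spec a.inv fun h => ha (by simp [h])
      exact ⟨l, hl, k, hk, h1.symm, by simp only [Gpd.inv] at h2; omega⟩)

lemma star_apply (f : T.ConvAlg) (a : T.Gpd) : star f a = conj (f a.inv) := rfl

lemma val_star (f : T.ConvAlg) (x : X) (n : ℤ) (y : X) :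
    (star f).val x n y = conj (f.val y (-n) x) := by
  by_cases h : T.IsArrow x n y
  · have h' : T.IsArrow y (-n) x := (Gpd.inv ⟨x, n, y, h⟩).isArrow
    rw [val, val, dif_pos h, dif_pos h']
    rfl
  · have h' : ¬ T.IsArrow y (-n) x := fun h' => h (by
      simpa [Gpd.inv] using (Gpd.inv ⟨y, -n, x, h'⟩).isArrow)
    rw [val, val, dif_neg h, dif_neg h', map_zero]

protected lemma star_mul (f g : T.ConvAlg) : star (f * g) = star g * star f := by
  refine ext_val fun x n y _ => ?_
  rw [val_star, val_mul, val_mul,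
    ← finsum_comp_equiv ((Equiv.subRight n).prodCongr (Equiv.refl X)),
    show conj _ = starAddEquiv (R := ℂ) _ from rfl, AddEquiv.map_finsum]
  refine finsum_congr fun a => ?_
  rw [val_star, val_star]
  simp only [Equiv.prodCongr_apply, Prod.map_fst, Prod.map_snd, Equiv.subRight_apply,
    Equiv.refl_apply, starAddEquiv_apply, star_mul', RCLike.star_def]
  rw [mul_comm]
  congr 4 <;> ring

end ConvAlg

lemma isClopen_R (k l : ℕ) : IsClopen (T.R k l) := ⟨(T.isCompact_R k l).isClosed, T.isOpen_R k l⟩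

variable (T) in
/-- The embedding of `C(X)` into `C_c(G)`, `ι(φ)(x, n, y) = φ(x) 1_{R_{0,0}}(x, n, y)`. -/
noncomputable def iotaFun (φ : C(X, ℂ)) : T.ConvAlg :=
  ConvAlg.mk ((T.R 0 0).indicator fun a => φ a.r)
    ((φ.continuous.comp T.continuous_r).indicator (by simp [(isClopen_R 0 0).frontier_eq])) 0
    fun _ ha => ⟨0, le_rfl, 0, le_rfl, mem_of_indicator_ne_zero ha⟩

open Classical in
lemma val_iotaFun (φ : C(X, ℂ)) (x : X) (n : ℤ) (y : X) :
    (T.iotaFun φ).val x n y = if n = 0 ∧ x = y then φ x else 0 := by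
  by_cases h : T.IsArrow x n y
  · rw [ConvAlg.val, dif_pos h]
    change (T.R 0 0).indicator (fun a => φ a.r) _ = _
    simp only [indicator_apply, mem_R_zero]
  · rw [ConvAlg.val_of_not _ h, if_neg]
    rintro ⟨rfl, rfl⟩
    exact h (isArrow_refl x)

lemma val_iotaFun_mul (φ : C(X, ℂ)) (f : T.ConvAlg) (x : X) (n : ℤ) (y : X) :
    (T.iotaFun φ * f).val x n y = φ x * f.val x n y := by
  rw [ConvAlg.val_mul, finsum_eq_single _ ((0 : ℤ), x)]
  · simp [val_iotaFun]
  · rintro ⟨p, z⟩ hpz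
    rw [val_iotaFun, if_neg, zero_mul]
    rintro ⟨rfl, rfl⟩
    exact hpz rfl

lemma val_mul_iotaFun (φ : C(X, ℂ)) (f : T.ConvAlg) (x : X) (n : ℤ) (y : X) :
    (f * T.iotaFun φ).val x n y = f.val x n y * φ y := by
  rw [ConvAlg.val_mul, finsum_eq_single _ (n, y)]
  · simp [val_iotaFun]
  · rintro ⟨p, z⟩ hpz
    rw [val_iotaFun, if_neg, mul_zero]
    rintro ⟨h, rfl⟩
    exact hpz (by rw [sub_eq_zero.1 h])

namespace ConvAlg

noncomputable instance : One T.ConvAlg := ⟨T.iotaFun 1⟩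

lemma one_def : (1 : T.ConvAlg) = T.iotaFun 1 := rfl

noncomputable instance : Ring T.ConvAlg :=
  { (inferInstance : AddCommGroup T.ConvAlg), (inferInstance : Mul T.ConvAlg),
    (inferInstance : One T.ConvAlg) with
    left_distrib := ConvAlg.mul_add
    right_distrib := ConvAlg.add_mul
    mul_assoc := ConvAlg.mul_assoc
    zero_mul := fun f => ext_val fun x n y _ => by
      rw [val_mul, val_zero]
      exact finsum_eq_zero_of_forall_eq_zero fun a => by rw [val_zero, zero_mul]
    mul_zero := fun f => ext_val fun x n y _ => by
      rw [val_mul, val_zero]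
      exact finsum_eq_zero_of_forall_eq_zero fun a => by rw [val_zero, mul_zero]
    one_mul := fun f => ext_val fun x n y _ => by rw [one_def, val_iotaFun_mul]; simp
    mul_one := fun f => ext_val fun x n y _ => by rw [one_def, val_mul_iotaFun]; simp }

noncomputable instance : Algebra ℂ T.ConvAlg :=
  Algebra.ofModule ConvAlg.smul_mul fun c f g => ConvAlg.mul_smul c f g

noncomputable instance : StarRing T.ConvAlg where
  star_involutive f := ext_val fun x n y _ => by simp [val_star]
  star_mul := ConvAlg.star_mul
  star_add f g := ext_val fun x n y _ => by simp [val_star, val_add]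

instance : StarModule ℂ T.ConvAlg where
  star_smul c f := ext_val fun x n y _ => by simp [val_star, val_smul]

end ConvAlg

variable (T) in
/-- The embedding of `C(X)` into `C_c(G)` as a unital `*`-homomorphism. -/
noncomputable def iotaHom : C(X, ℂ) →⋆ₐ[ℂ] T.ConvAlg where
  toFun := T.iotaFun
  map_one' := rfl
  map_mul' φ χ := ConvAlg.ext_val fun x n y _ => by
    rw [val_iotaFun_mul, val_iotaFun, val_iotaFun]
    simp
  map_zero' := ConvAlg.ext_val fun x n y _ => by rw [val_iotaFun, ConvAlg.val_zero]; simp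
  map_add' φ χ := ConvAlg.ext_val fun x n y _ => by
    simp only [ConvAlg.val_add, val_iotaFun]
    split_ifs <;> simp
  commutes' c := ConvAlg.ext_val fun x n y _ => by
    rw [Algebra.algebraMap_eq_smul_one (A := T.ConvAlg), ConvAlg.val_smul, ConvAlg.one_def,
      val_iotaFun, val_iotaFun]
    simp [Algebra.algebraMap_eq_smul_one]
  map_star' φ := ConvAlg.ext_val fun x n y _ => by
    rw [ConvAlg.val_star, val_iotaFun, val_iotaFun]
    by_cases h : n = 0 ∧ x = y
    · obtain ⟨rfl, rfl⟩ := h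
      simp
    · rw [if_neg h, if_neg fun h' => h ⟨by omega, h'.2.symm⟩, map_zero]

/-- The sum of a continuous function over the fibres of `T` is continuous. -/
lemma continuous_fiberSum (h : C(X, ℂ)) : Continuous fun x => ∑ᶠ y ∈ T ⁻¹' {x}, h y := by
  classical
  rw [continuous_iff_continuousAt]
  intro x₀
  obtain ⟨F, σ, hF, hev⟩ := exists_finite_sections T.isLocalHomeomorph.continuous
    (K := (univ : Set X)) isCompact_univ x₀ (fun z hz => by
      subst hz
      exact T.exists_section_iterate 1 z)
  have key : ContinuousAt (fun x => ∑ e ∈ F, h (σ e x)) x₀ :=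
    tendsto_finsetSum _ fun e he => (h.continuous.tendsto _).comp (hF e he).2.1
  refine key.congr (hev.mono fun x ⟨h1, h2, h3⟩ => ?_)
  have hs : T ⁻¹' {x} = ((F.image fun e => σ e x : Finset X) : Set X) := by
    ext y
    simp only [mem_preimage, mem_singleton_iff, Finset.coe_image, mem_image, Finset.mem_coe]
    refine ⟨fun hy => h3 y (mem_univ _) hy, ?_⟩
    rintro ⟨e, he, rfl⟩
    exact h1 e he
  change ∑ e ∈ F, h (σ e x) = ∑ᶠ y ∈ T ⁻¹' {x}, h y
  rw [hs, finsum_mem_coe_finset, Finset.sum_image h2]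

variable (T) in
/-- The fibres of `T` are finite. -/
lemma finite_fiber (x : X) : (T ⁻¹' {x}).Finite := by
  obtain ⟨F, σ, hF, hev⟩ := exists_finite_sections T.isLocalHomeomorph.continuous
    (K := (univ : Set X)) isCompact_univ x (fun z hz => by
      subst hz
      exact T.exists_section_iterate 1 z)
  refine (F.finite_toSet).subset fun y hy => ?_
  obtain ⟨e, he, hee⟩ := hev.self_of_nhds.2.2 y (mem_univ _) hy
  rw [(hF e he).2.2] at hee
  exact hee ▸ he

variable (T) in
/-- The number `|T⁻¹(x)|` of preimages of `x`. -/
noncomputable def fiberCard (x : X) : ℕ := (T ⁻¹' {x}).ncard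

lemma fiberCard_pos (x : X) : 0 < T.fiberCard x := by
  rw [fiberCard, Set.ncard_pos (T.finite_fiber x)]
  exact T.surjective x

lemma continuous_fiberCard : Continuous fun x => (T.fiberCard x : ℂ) := by
  convert continuous_fiberSum (T := T) 1 with x
  rw [finsum_mem_eq_finite_toFinset_sum _ (T.finite_fiber x), fiberCard,
    Set.ncard_eq_toFinset_card _ (T.finite_fiber x)]
  simp

lemma continuous_fiberCard_real : Continuous fun x => (T.fiberCard x : ℝ) := 
  Complex.continuous_re.comp (continuous_fiberCard (T := T))

variable (T) in
/-- The function `S` on the groupoid: `S(x, 1, y) = 1 / √|T⁻¹(Tx)|` if `y = Tx`, and `S = 0` off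
the set `R_{1,0}` of these arrows. -/
noncomputable def isoFun : T.ConvAlg :=
  ConvAlg.mk ((T.R 1 0).indicator fun a => ((1 / √(T.fiberCard (T a.r) : ℝ) : ℝ) : ℂ))
    (Continuous.indicator (by simp [(isClopen_R 1 0).frontier_eq])
      (Complex.continuous_ofReal.comp (continuous_const.div
        (Real.continuous_sqrt.comp ((continuous_fiberCard_real (T := T)).comp
          (T.isLocalHomeomorph.continuous.comp T.continuous_r)))
        fun a => (Real.sqrt_pos.2 (Nat.cast_pos.2 (fiberCard_pos _))).ne'))) 1
    fun _ ha => ⟨1, le_rfl, 0, zero_le_one, mem_of_indicator_ne_zero ha⟩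

/-- A representation of `C_c(G)` on the Hilbert space `H`: a `*`-homomorphism into the bounded
operators that is continuous from the inductive limit topology to the weak operator topology, i.e.
all matrix coefficients are bounded with respect to the supremum norm on the space of the functions
supported in a fixed compact set. -/
structure Rep (T : SurjLocalHomeo X) (H : Type u) [NormedAddCommGroup H] [InnerProductSpace ℂ H]
    [CompleteSpace H] where
  /-- the underlying `*`-homomorphism -/
  hom : T.ConvAlg →⋆ₙₐ[ℂ] (H →L[ℂ] H)
  bounded_on_compacts : ∀ K : Set T.Gpd, IsCompact K → ∀ ξ η : H, ∃ C : ℝ,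
    ∀ (f : T.ConvAlg) (M : ℝ), 0 ≤ M → (∀ a, a ∉ K → f a = 0) → (∀ a, ‖f a‖ ≤ M) →
      ‖inner ℂ ξ (hom f η)‖ ≤ C * M

/-- If `g g⋆` lies in `C(X)`, then `g` is bounded in all representations by the same constant. -/
lemma exists_bound_of_diag (g : T.ConvAlg) (h0 : ∀ x n y, (g * star g).val x n y ≠ 0 →
    n = 0 ∧ x = y) : ∃ C : ℝ, ∀ (H : Type u) [NormedAddCommGroup H] [InnerProductSpace ℂ H]
    [CompleteSpace H] (π : T.ConvAlg →⋆ₙₐ[ℂ] (H →L[ℂ] H)), ‖π g‖ ≤ C := by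
  let h : C(X, ℂ) := ⟨fun x => (g * star g).val x 0 x, continuous_iff_continuousAt.2 fun x =>
    ConvAlg.continuousAt_val _ continuousAt_id continuousAt_id 0 0
      (Eventually.of_forall fun y => ⟨rfl, by simp⟩)⟩
  have hg : g * star g = T.iotaHom h := ConvAlg.ext_val fun x n y _ => by
    change _ = (T.iotaFun h).val x n y
    rw [val_iotaFun]
    split_ifs with hc
    · obtain ⟨rfl, rfl⟩ := hc
      rfl
    · by_contra hne
      exact hc (h0 _ _ _ hne)
  refine ⟨√‖h‖, fun H _ _ _ π => Real.le_sqrt_of_sq_le ?_⟩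
  have h1 : ‖π.comp (T.iotaHom : C(X, ℂ) →⋆ₙₐ[ℂ] T.ConvAlg) h‖ ≤ ‖h‖ :=
    NonUnitalStarAlgHom.norm_apply_le _ _
  rw [sq, ← CStarRing.norm_self_mul_star, ← map_star, ← map_mul, hg]
  exact h1

/-- Every element of `C_c(G)` is bounded in all representations by the same constant. -/
lemma exists_bound (f : T.ConvAlg) : ∃ C : ℝ, ∀ (H : Type u) [NormedAddCommGroup H]
    [InnerProductSpace ℂ H] [CompleteSpace H] (π : T.ConvAlg →⋆ₙₐ[ℂ] (H →L[ℂ] H)),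
    ‖π f‖ ≤ C := by
  classical
  obtain ⟨N, hN⟩ := f.exists_bdd
  choose U hU hxU hUi using (T.isLocalHomeomorph_iterate N).isLocallyInjective
  obtain ⟨ψ, hψ⟩ := PartitionOfUnity.exists_isSubordinate isClosed_univ U hU
    fun x _ => mem_iUnion.2 ⟨x, hxU x⟩
  have hI : {i | (support (ψ i)).Nonempty}.Finite := ψ.locallyFinite.finite_nonempty_of_compact
  have hm : ∀ m : ℤ, IsClopen {a : T.Gpd | a.d = m} := fun m =>
    (isClopen_discrete {m}).preimage T.continuous_d
  let g : X → ℤ → T.ConvAlg := fun i m => ConvAlg.mk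
    (fun a => (ψ i a.r : ℂ) * {a : T.Gpd | a.d = m}.indicator f a)
    ((Complex.continuous_ofReal.comp ((ψ i).continuous.comp T.continuous_r)).mul
      (Continuous.indicator (by simp [(hm m).frontier_eq]) f.continuous_toFun)) N
    fun a ha => hN a fun h => ha (by simp [indicator_apply, h])
  have hgval : ∀ i m x n y, (g i m).val x n y ≠ 0 → n = m ∧ x ∈ U i ∧
      ∃ k ≤ N, ∃ l ≤ N, T^[k] x = T^[l] y ∧ n = (k : ℤ) - l := by
    intro i m x n y h
    by_cases hA : T.IsArrow x n y
    · rw [ConvAlg.val, dif_pos hA] at h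
      have h' : (ψ i x : ℂ) * {a : T.Gpd | a.d = m}.indicator f ⟨x, n, y, hA⟩ ≠ 0 := h
      have h1 := left_ne_zero_of_mul h'
      have h2 := right_ne_zero_of_mul h'
      refine ⟨mem_of_indicator_ne_zero (s := {a : T.Gpd | a.d = m}) h2, hψ i (subset_tsupport _ fun h0 => h1 (by simp [h0])), ?_⟩
      exact hN ⟨x, n, y, hA⟩ fun h0 => h2 (by simp [indicator_apply, h0])
    · exact absurd (ConvAlg.val_of_not _ hA) h
  have hdiag : ∀ i m x n y, (g i m * star (g i m)).val x n y ≠ 0 → n = 0 ∧ x = y := by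
    intro i m x n y h
    rw [ConvAlg.val_mul] at h
    obtain ⟨p, z, h1, h2⟩ := ConvAlg.conv_ne_zero h
    rw [ConvAlg.val_star] at h2
    replace h2 : (g i m).val y (-(n - p)) z ≠ 0 := fun h0 => h2 (by rw [h0, map_zero])
    obtain ⟨e1, hx, k, hk, l, hl, e2, e3⟩ := hgval _ _ _ _ _ h1
    obtain ⟨e1', hy, k', hk', l', hl', e2', e3'⟩ := hgval _ _ _ _ _ h2
    refine ⟨by omega, hUi i hx hy ?_⟩
    obtain ⟨c, hc⟩ := Nat.exists_eq_add_of_le hk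
    obtain ⟨c', hc'⟩ := Nat.exists_eq_add_of_le hk'
    have : c + l = c' + l' := by omega
    calc T^[N] x = T^[c] (T^[k] x) := by rw [← iterate_add_apply, hc, add_comm]
      _ = T^[c + l] z := by rw [e2, ← iterate_add_apply]
      _ = T^[c'] (T^[k'] y) := by rw [this, iterate_add_apply, ← e2']
      _ = T^[N] y := by rw [← iterate_add_apply, hc', add_comm]
  have hsum : f = ∑ m ∈ Finset.Icc (-(N : ℤ)) N, ∑ i ∈ hI.toFinset, g i m := by
    have happ : ∀ (s : Finset X) (t : Finset ℤ) (a : T.Gpd),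
        (∑ m ∈ t, ∑ i ∈ s, g i m) a = ∑ m ∈ t, ∑ i ∈ s, g i m a := by
      intro s t a
      let ev : T.ConvAlg →+ ℂ := ⟨⟨fun f => f a, rfl⟩, fun _ _ => rfl⟩
      change ev _ = ∑ m ∈ t, ∑ i ∈ s, ev (g i m)
      rw [map_sum]
      simp_rw [map_sum]
    refine DFunLike.ext _ _ fun a => ?_
    rw [happ]
    change _ = ∑ m ∈ Finset.Icc (-(N : ℤ)) N, ∑ i ∈ hI.toFinset,
      (ψ i a.r : ℂ) * {a : T.Gpd | a.d = m}.indicator f a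
    have h1 : ∑ i ∈ hI.toFinset, (ψ i a.r : ℂ) = 1 := by
      have := ψ.sum_eq_one (mem_univ a.r)
      rw [finsum_eq_sum_of_support_subset (s := hI.toFinset)] at this
      · exact_mod_cast this
      · intro i hi
        simp only [Finite.coe_toFinset]
        exact ⟨a.r, hi⟩
    simp_rw [← Finset.sum_mul, h1, one_mul]
    by_cases h0 : f a = 0
    · simp [indicator_apply, h0]
    · obtain ⟨k, hk, l, hl, -, h⟩ := hN a h0
      simp only [indicator_apply, mem_ofPred_eq, Finset.sum_ite_eq]
      rw [if_pos]
      rw [Finset.mem_Icc]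
      omega
  choose C hC using fun i m => exists_bound_of_diag (g i m) (hdiag i m)
  refine ⟨∑ m ∈ Finset.Icc (-(N : ℤ)) N, ∑ i ∈ hI.toFinset, C i m, fun H _ _ _ π => ?_⟩
  rw [hsum, map_sum]
  refine norm_sum_le_of_le _ fun m _ => ?_
  rw [map_sum]
  exact norm_sum_le_of_le _ fun i _ => hC i m H π

/-- The set of the norms of `f` in the representations of `C_c(G)`. -/
def repNorms (f : T.ConvAlg) : Set ℝ :=
  {c | ∃ (H : Type u) (_ : NormedAddCommGroup H) (_ : InnerProductSpace ℂ H)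
    (_ : CompleteSpace H) (π : T.Rep H), c = ‖π.hom f‖}

lemma bddAbove_repNorms (f : T.ConvAlg) : BddAbove (repNorms f) := by
  obtain ⟨C, hC⟩ := exists_bound f
  refine ⟨C, ?_⟩
  rintro _ ⟨H, _, _, _, π, rfl⟩
  exact hC H π.hom

lemma repNorms_nonempty (f : T.ConvAlg) : (repNorms f).Nonempty :=
  ⟨_, PUnit, inferInstance, inferInstance, inferInstance,
    ⟨0, fun K _ ξ η => ⟨0, fun f M _ _ _ => by simp⟩⟩, rfl⟩

/-- The norm of `C⋆(G)` on `C_c(G)`: the supremum of `‖π(f)‖` over all representations `π`. (It is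
enough to let the Hilbert spaces range over the universe of `X`, since `‖π(f)‖` is a supremum over
the cyclic subrepresentations of `π`, each of which is realized on a completion of a quotient of
`C_c(G)`.) -/
noncomputable def univNorm (f : T.ConvAlg) : ℝ := sSup (repNorms f)

lemma le_univNorm (f : T.ConvAlg) {H : Type u} [NormedAddCommGroup H] [InnerProductSpace ℂ H]
    [CompleteSpace H] (π : T.Rep H) : ‖π.hom f‖ ≤ univNorm f :=
  le_csSup (bddAbove_repNorms f) ⟨H, _, _, _, π, rfl⟩

lemma univNorm_le (f : T.ConvAlg) {C : ℝ} (h : ∀ (H : Type u) [NormedAddCommGroup H]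
    [InnerProductSpace ℂ H] [CompleteSpace H] (π : T.Rep H), ‖π.hom f‖ ≤ C) : univNorm f ≤ C := by
  refine csSup_le (repNorms_nonempty f) ?_
  rintro _ ⟨H, _, _, _, π, rfl⟩
  exact h H π

lemma univNorm_nonneg (f : T.ConvAlg) : 0 ≤ univNorm f := by
  refine Real.sSup_nonneg ?_
  rintro _ ⟨H, _, _, _, π, rfl⟩
  exact norm_nonneg _

variable (T) in
/-- The universal norm as a ring seminorm. -/
noncomputable def univSeminorm : RingSeminorm T.ConvAlg where
  toFun := univNorm
  map_zero' := le_antisymm (univNorm_le _ fun H _ _ _ π => by simp) (univNorm_nonneg _)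
  add_le' f g := univNorm_le _ fun H _ _ _ π => by
    rw [map_add]
    exact (norm_add_le _ _).trans (add_le_add (le_univNorm f π) (le_univNorm g π))
  neg' f := by
    unfold univNorm repNorms
    simp only [map_neg, norm_neg]
  mul_le' f g := univNorm_le _ fun H _ _ _ π => by
    rw [map_mul]
    exact (norm_mul_le _ _).trans (mul_le_mul (le_univNorm f π) (le_univNorm g π)
      (norm_nonneg _) (univNorm_nonneg _))

noncomputable instance : SeminormedRing T.ConvAlg := (univSeminorm T).toSeminormedRing

lemma norm_def (f : T.ConvAlg) : ‖f‖ = univNorm f := rfl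

noncomputable instance : NormedAlgebra ℂ T.ConvAlg where
  norm_smul_le c f := univNorm_le _ fun H _ _ _ π => by
    rw [map_smul, norm_smul]
    exact mul_le_mul_of_nonneg_left (le_univNorm f π) (norm_nonneg _)

lemma norm_star_convAlg (f : T.ConvAlg) : ‖star f‖ = ‖f‖ := by
  simp only [norm_def, univNorm, repNorms, map_star, norm_star]

lemma norm_sq_le_convAlg (f : T.ConvAlg) : ‖f‖ * ‖f‖ ≤ ‖star f * f‖ := by
  rw [← sq]
  refine (Real.le_sqrt (univNorm_nonneg f) (norm_nonneg _)).1 ?_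
  refine univNorm_le _ fun H _ _ _ π => Real.le_sqrt_of_sq_le ?_
  rw [sq, ← CStarRing.norm_star_mul_self, ← map_star, ← map_mul]
  exact le_univNorm (star f * f) π

lemma isometry_star_convAlg : Isometry (star : T.ConvAlg → T.ConvAlg) :=
  AddMonoidHomClass.isometry_of_norm (starAddEquiv : T.ConvAlg ≃+ T.ConvAlg) norm_star_convAlg

/-- The groupoid `C⋆`-algebra `C⋆(G)`: the completion of `C_c(G)` in the universal norm. -/
def CStarG {X : Type u} [TopologicalSpace X] [CompactSpace X] [T2Space X]
    (T : SurjLocalHomeo X) : Type u := UniformSpace.Completion T.ConvAlg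

namespace CStarG

noncomputable instance : NormedRing T.CStarG :=
  inferInstanceAs (NormedRing (UniformSpace.Completion T.ConvAlg))

noncomputable instance : Algebra ℂ T.CStarG :=
  inferInstanceAs (Algebra ℂ (UniformSpace.Completion T.ConvAlg))

instance : CompleteSpace T.CStarG :=
  inferInstanceAs (CompleteSpace (UniformSpace.Completion T.ConvAlg))

noncomputable instance : Star T.CStarG where
  star := UniformSpace.Completion.map (star : T.ConvAlg → T.ConvAlg)

variable (T) in
/-- The canonical map from `C_c(G)` to its completion `C⋆(G)`. -/
noncomputable def of (f : T.ConvAlg) : T.CStarG := (f : UniformSpace.Completion T.ConvAlg)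

lemma continuous_star : Continuous (star : T.CStarG → T.CStarG) :=
  UniformSpace.Completion.continuous_map

lemma star_of (f : T.ConvAlg) : star (of T f) = of T (star f) :=
  UniformSpace.Completion.map_coe isometry_star_convAlg.uniformContinuous f

lemma of_add (f g : T.ConvAlg) : of T (f + g) = of T f + of T g :=
  UniformSpace.Completion.coe_add f g

lemma of_mul (f g : T.ConvAlg) : of T (f * g) = of T f * of T g :=
  UniformSpace.Completion.coe_mul f g

lemma of_one : of T 1 = 1 := rfl

lemma of_smul (c : ℂ) (f : T.ConvAlg) : of T (c • f) = c • of T f :=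
  UniformSpace.Completion.coe_smul c f

lemma norm_of (f : T.ConvAlg) : ‖of T f‖ = ‖f‖ := UniformSpace.Completion.norm_coe f

lemma denseRange_of : DenseRange (of T) := UniformSpace.Completion.denseRange_coe

noncomputable instance : StarRing T.CStarG where
  star_involutive a := denseRange_of.induction_on a
    (isClosed_eq (continuous_star.comp continuous_star) continuous_id)
    fun f => by rw [star_of, star_of, star_star]
  star_mul a b := denseRange_of.induction_on₂
    (isClosed_eq (continuous_star.comp continuous_mul)
      ((continuous_star.comp continuous_snd).mul (continuous_star.comp continuous_fst)))
    (fun f g => by rw [← of_mul, star_of, star_of, star_of, ← of_mul, star_mul]) a b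
  star_add a b := denseRange_of.induction_on₂
    (isClosed_eq (continuous_star.comp continuous_add)
      ((continuous_star.comp continuous_fst).add (continuous_star.comp continuous_snd)))
    (fun f g => by rw [← of_add, star_of, star_of, star_of, ← of_add, star_add]) a b

noncomputable instance : NormedAlgebra ℂ T.CStarG where
  norm_smul_le c a := denseRange_of.induction_on a
    (isClosed_le (continuous_norm.comp (show Continuous fun b : T.CStarG => c • b from
      UniformSpace.Completion.uniformContinuous_map.continuous))
      (continuous_const.mul continuous_norm))
    fun f => by
      rw [← of_smul, norm_of, norm_of]
      exact norm_smul_le c f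

instance : StarModule ℂ T.CStarG where
  star_smul c a := denseRange_of.induction_on a
    (isClosed_eq (continuous_star.comp (continuous_id.const_smul c))
      (continuous_star.const_smul (star c)))
    fun f => by rw [star_of, ← of_smul, ← of_smul, star_of, star_smul]

instance : CStarRing T.CStarG where
  norm_mul_self_le a := denseRange_of.induction_on a
    (isClosed_le (continuous_norm.mul continuous_norm)
      (continuous_norm.comp (continuous_star.mul continuous_id)))
    fun f => by
      rw [star_of, ← of_mul, norm_of, norm_of]
      exact norm_sq_le_convAlg f

noncomputable instance : CStarAlgebra T.CStarG where

end CStarG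

variable (T)

/-- The homomorphism `ι : C(X) → C⋆(G)`, `ι(φ)(x, n, y) = φ(x) 1_{R_{0,0}}(x, n, y)`. -/
noncomputable def iota (φ : C(X, ℂ)) : T.CStarG := CStarG.of T (T.iotaFun φ)

/-- The element `S` of `C⋆(G)`. -/
noncomputable def S : T.CStarG := CStarG.of T T.isoFun

/-- The endomorphism `β(f) = f ∘ T` of `C(X)`. -/
noncomputable def beta (f : C(X, ℂ)) : C(X, ℂ) := f.comp ⟨T, T.isLocalHomeomorph.continuous⟩

/-- The `C(X)`-valued inner product of the Deaconu correspondence,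
`⟨ξ, η⟩(x) = 1 / |T⁻¹(x)| ∑_{Ty = x} conj (ξ(y)) η(y)`. -/
noncomputable def deaconuInner (ξ η : C(X, ℂ)) : C(X, ℂ) where
  toFun x := 1 / (T.fiberCard x : ℂ) * ∑ᶠ y ∈ T ⁻¹' {x}, conj (ξ y) * η y
  continuous_toFun := (continuous_const.div continuous_fiberCard fun x =>
    Nat.cast_ne_zero.2 (fiberCard_pos x).ne').mul (continuous_fiberSum (star ξ * η))

/-- The right action `(ξ · b)(x) = ξ(x) b(Tx)` of `C(X)` on the Deaconu correspondence. -/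
noncomputable def deaconuSMul (ξ b : C(X, ℂ)) : C(X, ℂ) := ξ * T.beta b

/-- The norm `‖⟨ξ, ξ⟩‖ ^ (1 / 2)` on `C(X)` is equivalent to the supremum norm, so `C(X)` is
complete in it: the module of the Deaconu correspondence, which is the completion of `C(X)` in this
norm, is `C(X)` itself. -/
theorem deaconu_norm_equiv : ∃ C : ℝ, ∀ ξ : C(X, ℂ),
    ‖ξ‖ ^ 2 ≤ C * ‖T.deaconuInner ξ ξ‖ ∧ ‖T.deaconuInner ξ ξ‖ ≤ ‖ξ‖ ^ 2 := by
  let κ : C(X, ℂ) := ⟨fun x => (T.fiberCard x : ℂ), continuous_fiberCard⟩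
  have hκ : ∀ x, (T.fiberCard x : ℝ) ≤ ‖κ‖ := fun x => by
    simpa [κ] using κ.norm_coe_le_norm x
  have hval : ∀ (ξ : C(X, ℂ)) (x : X), ‖T.deaconuInner ξ ξ x‖ =
      1 / (T.fiberCard x : ℝ) * ∑ y ∈ (T.finite_fiber x).toFinset, ‖ξ y‖ ^ 2 := by
    intro ξ x
    have : T.deaconuInner ξ ξ x =
        ((1 / (T.fiberCard x : ℝ) * ∑ y ∈ (T.finite_fiber x).toFinset, ‖ξ y‖ ^ 2 : ℝ) : ℂ) := by
      change 1 / (T.fiberCard x : ℂ) * ∑ᶠ y ∈ T ⁻¹' {x}, conj (ξ y) * ξ y = _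
      rw [finsum_mem_eq_finite_toFinset_sum _ (T.finite_fiber x)]
      push_cast
      congr 1
      exact Finset.sum_congr rfl fun y _ => Complex.conj_mul' _
    rw [this, Complex.norm_real, Real.norm_of_nonneg (by positivity)]
  refine ⟨‖κ‖, fun ξ => ⟨?_, ?_⟩⟩
  · refine (Real.le_sqrt (norm_nonneg _) (by positivity)).1 ((ContinuousMap.norm_le _ (Real.sqrt_nonneg _)).2 ?_)
    intro y
    refine Real.le_sqrt_of_sq_le ?_
    have h1 := (T.deaconuInner ξ ξ).norm_coe_le_norm (T y)
    have hpos : (0 : ℝ) < T.fiberCard (T y) := Nat.cast_pos.2 (fiberCard_pos _)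
    calc ‖ξ y‖ ^ 2 ≤ ∑ z ∈ (T.finite_fiber (T y)).toFinset, ‖ξ z‖ ^ 2 :=
          Finset.single_le_sum (f := fun z => ‖ξ z‖ ^ 2) (fun z _ => by positivity) (by simp)
      _ = T.fiberCard (T y) * ‖T.deaconuInner ξ ξ (T y)‖ := by
          rw [hval]
          field_simp
      _ ≤ ‖κ‖ * ‖T.deaconuInner ξ ξ‖ := mul_le_mul (hκ _) h1 (norm_nonneg _) (norm_nonneg _)
  · rw [ContinuousMap.norm_le _ (by positivity)]
    intro x
    have hpos : (0 : ℝ) < T.fiberCard x := Nat.cast_pos.2 (fiberCard_pos _)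
    rw [hval, one_div, inv_mul_le_iff₀ hpos]
    calc ∑ y ∈ (T.finite_fiber x).toFinset, ‖ξ y‖ ^ 2
        ≤ ∑ _y ∈ (T.finite_fiber x).toFinset, ‖ξ‖ ^ 2 :=
          Finset.sum_le_sum fun y _ => by
            gcongr
            exact ξ.norm_coe_le_norm y
      _ = T.fiberCard x * ‖ξ‖ ^ 2 := by
          rw [Finset.sum_const, nsmul_eq_mul, fiberCard,
            Set.ncard_eq_toFinset_card _ (T.finite_fiber x)]

/-- A filter bank: a finite orthonormal basis of the Deaconu correspondence. -/
structure IsFilterBank {n : ℕ} (m : Fin n → C(X, ℂ)) : Prop where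
  orthonormal : ∀ i j, T.deaconuInner (m i) (m j) = if i = j then 1 else 0
  generates : ∀ ξ : C(X, ℂ), ∃ b : Fin n → C(X, ℂ), ξ = ∑ i, T.deaconuSMul (m i) (b i)

/-- The map `ψ(ξ) = ι(ξ) S` of the Deaconu correspondence into `C⋆(G)`. -/
noncomputable def psi (ξ : C(X, ℂ)) : T.CStarG := T.iota ξ * T.S

end

end SurjLocalHomeo

/-- A Cuntz family of isometries in a unital `C⋆`-algebra: `Sᵢ⋆ Sⱼ = δᵢⱼ 1` and `∑ Sᵢ Sᵢ⋆ = 1`. -/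
structure IsCuntzFamily {A : Type*} [CStarAlgebra A] {n : ℕ} (S : Fin n → A) : Prop where
  star_mul : ∀ i j, star (S i) * S j = if i = j then 1 else 0
  sum_mul_star : ∑ i, S i * star (S i) = 1

/-!
All identities take place in the image of `C_c(G)` in `C⋆(G)`, where they become pointwise
identities of functions on the groupoid. The function of `ψ(ξ)` is supported on the arrows
`(x, 1, Tx)`, where its value is `ξ(x) / √|T⁻¹(Tx)|`. Hence

* `ι(a) S` and `S ι(b)` are `S` multiplied by `a(x)` and by `b(Tx)` respectively, which gives the
  covariance relation (`iota_beta_mul_S`) and from it `iota_beta_mul_psi`;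
* `ψ(ξ)⋆ ψ(η) = ι(⟨ξ, η⟩)` (`star_psi_mul_psi`), since the convolution at `(x, 0, x)` is a sum over
  the fibre `T⁻¹(x)`;
* `ψ(ξ) ψ(η)⋆` has at `(x, 0, y)`, `Tx = Ty`, the value `ξ(x) conj (η(y)) / |T⁻¹(Tx)|`.

By the last formula `∑ Sᵢ Sᵢ⋆ = 1` says that the matrix
`∑ᵢ mᵢ(x) conj (mᵢ(y)) / |T⁻¹(Tx)|`, indexed by a fibre of `T`, is the identity
(`IsFilterBank.sum_mul_conj`). This is the reconstruction formula `ξ = ∑ mᵢ · ⟨mᵢ, ξ⟩` of an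
orthonormal basis, applied to a `ξ` that is `1` at one point of the fibre and `0` at the others.
The formula for `ι(β(a))` is then `ι(β(a)) ∑ Sᵢ Sᵢ⋆` with the covariance relation applied to each
term.
-/

namespace SurjLocalHomeo

lemma one_div_sqrt_natCast_mul_self (k : ℕ) :
    ((1 / √(k : ℝ) : ℝ) : ℂ) * ((1 / √(k : ℝ) : ℝ) : ℂ) = 1 / (k : ℂ) := by
  rw [← Complex.ofReal_mul, div_mul_div_comm, one_mul, Real.mul_self_sqrt (Nat.cast_nonneg _)]
  push_cast
  rfl

variable {X : Type u} [TopologicalSpace X] [CompactSpace X] [T2Space X] {T : SurjLocalHomeo X}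

/-! ### The functions on the groupoid -/

open Classical in
lemma val_isoFun (x : X) (n : ℤ) (y : X) : T.isoFun.val x n y =
    if n = 1 ∧ T x = y then ((1 / √(T.fiberCard (T x) : ℝ) : ℝ) : ℂ) else 0 := by
  by_cases h : T.IsArrow x n y
  · rw [ConvAlg.val, dif_pos h]
    change (T.R 1 0).indicator (fun a => ((1 / √(T.fiberCard (T a.r) : ℝ) : ℝ) : ℂ)) _ = _
    simp only [indicator_apply, R, mem_ofPred_eq, iterate_one, iterate_zero, id_eq,
      Nat.cast_one, Nat.cast_zero, sub_zero, and_comm]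
  · rw [ConvAlg.val_of_not _ h, if_neg]
    rintro ⟨rfl, rfl⟩
    exact h ⟨1, 0, rfl, by simp⟩

variable (T) in
/-- The function `ι(ξ) S` in `C_c(G)` that represents `ψ(ξ)`. -/
noncomputable def psiFun (ξ : C(X, ℂ)) : T.ConvAlg := T.iotaFun ξ * T.isoFun

open Classical in
lemma val_psiFun (ξ : C(X, ℂ)) (x : X) (n : ℤ) (y : X) : (T.psiFun ξ).val x n y =
    if n = 1 ∧ T x = y then ξ x * ((1 / √(T.fiberCard (T x) : ℝ) : ℝ) : ℂ) else 0 := by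
  rw [psiFun, val_iotaFun_mul, val_isoFun, mul_ite, mul_zero]

lemma psi_eq_of (ξ : C(X, ℂ)) : T.psi ξ = CStarG.of T (T.psiFun ξ) :=
  (CStarG.of_mul _ _).symm

lemma star_psiFun_mul_psiFun (ξ η : C(X, ℂ)) :
    star (T.psiFun ξ) * T.psiFun η = T.iotaFun (T.deaconuInner ξ η) := by
  classical
  refine ConvAlg.ext_val fun x n y _ => ?_
  -- Only the arrows `(x, -1, z)` with `Tz = x` contribute to the convolution.
  rw [ConvAlg.val_mul_eq_sum _ _ x n y
    (s := (T.finite_fiber x).toFinset.map ⟨fun z => ((-1 : ℤ), z), Prod.mk_right_injective _⟩),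
    Finset.sum_map, val_iotaFun]
  · simp only [Embedding.coeFn_mk, ConvAlg.val_star, val_psiFun]
    by_cases h : n = 0 ∧ x = y
    · obtain ⟨rfl, rfl⟩ := h
      change _ = if _ then 1 / (T.fiberCard x : ℂ) * ∑ᶠ y ∈ T ⁻¹' {x}, conj (ξ y) * η y else 0
      rw [if_pos ⟨rfl, rfl⟩, finsum_mem_eq_finite_toFinset_sum _ (T.finite_fiber x),
        Finset.mul_sum]
      refine Finset.sum_congr rfl fun z hz => ?_
      have hz' : T z = x := by simpa using hz
      rw [if_pos ⟨by norm_num, hz'⟩, if_pos ⟨by norm_num, hz'⟩, hz',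
        ← one_div_sqrt_natCast_mul_self, map_mul, Complex.conj_ofReal]
      ring
    · rw [if_neg h]
      refine Finset.sum_eq_zero fun z hz => ?_
      have hz' : T z = x := by simpa using hz
      rw [if_neg (c := _ ∧ T z = y), mul_zero]
      rintro ⟨h1, h2⟩
      exact h ⟨by omega, hz'.symm.trans h2⟩
  · rintro ⟨p, z⟩ hp -
    rw [ConvAlg.val_star, val_psiFun] at hp
    split_ifs at hp with h
    · obtain ⟨h1, h2⟩ := h
      obtain rfl : p = -1 := by omega
      exact Finset.mem_map.2 ⟨z, by simpa using h2, rfl⟩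
    · exact absurd (map_zero _) hp

open Classical in
lemma val_psiFun_mul_star_psiFun (ξ η : C(X, ℂ)) (x : X) (n : ℤ) (y : X) :
    (T.psiFun ξ * star (T.psiFun η)).val x n y =
      if n = 0 ∧ T x = T y then 1 / (T.fiberCard (T x) : ℂ) * (ξ x * conj (η y)) else 0 := by
  rw [ConvAlg.val_mul, finsum_eq_single _ ((1 : ℤ), T x)]
  · simp only [ConvAlg.val_star, val_psiFun, and_self, if_true]
    by_cases h : n = 0 ∧ T x = T y
    · obtain ⟨rfl, h⟩ := h
      rw [if_pos ⟨by norm_num, h.symm⟩, if_pos ⟨rfl, h⟩, ← one_div_sqrt_natCast_mul_self, h,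
        map_mul, Complex.conj_ofReal]
      ring
    · rw [if_neg h, if_neg (fun h' => h ⟨by omega, h'.2.symm⟩), map_zero, mul_zero]
  · rintro ⟨p, z⟩ hpz
    rw [val_psiFun, if_neg, zero_mul]
    rintro ⟨rfl, rfl⟩
    exact hpz rfl

/-! ### Orthonormal bases of the Deaconu correspondence -/

lemma deaconuInner_sum_deaconuSMul {n : ℕ} (m b : Fin n → C(X, ℂ)) (ξ : C(X, ℂ)) :
    T.deaconuInner ξ (∑ j, T.deaconuSMul (m j) (b j)) = ∑ j, T.deaconuInner ξ (m j) * b j := by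
  ext x
  rw [ContinuousMap.sum_apply]
  change 1 / (T.fiberCard x : ℂ) * ∑ᶠ y ∈ T ⁻¹' {x}, _ =
    ∑ j, (1 / (T.fiberCard x : ℂ) * ∑ᶠ y ∈ T ⁻¹' {x}, conj (ξ y) * m j y) * b j x
  simp_rw [finsum_mem_eq_finite_toFinset_sum _ (T.finite_fiber x), mul_assoc, ← Finset.mul_sum,
    Finset.sum_mul]
  rw [Finset.sum_comm]
  congr 1
  refine Finset.sum_congr rfl fun y hy => ?_
  have hy' : T y = x := by simpa using hy
  rw [ContinuousMap.sum_apply, Finset.mul_sum]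
  refine Finset.sum_congr rfl fun j _ => ?_
  change conj (ξ y) * (m j y * b j (T y)) = _
  rw [hy', mul_assoc]

/-- The reconstruction formula: the coefficients in a filter bank are the inner products. -/
lemma IsFilterBank.eq_sum {n : ℕ} {m : Fin n → C(X, ℂ)} (hm : T.IsFilterBank m) (ξ : C(X, ℂ)) :
    ξ = ∑ i, T.deaconuSMul (m i) (T.deaconuInner (m i) ξ) := by
  obtain ⟨b, hb⟩ := hm.generates ξ
  have h (i : Fin n) : T.deaconuInner (m i) ξ = b i := by
    rw [hb, deaconuInner_sum_deaconuSMul]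
    simp [hm.orthonormal]
  simp_rw [h]
  exact hb

open Classical in
/-- On each fibre of `T` the matrix `∑ᵢ mᵢ(x) conj (mᵢ(y)) / |T⁻¹(Tx)|` of a filter bank is the
identity. -/
lemma IsFilterBank.sum_mul_conj {n : ℕ} {m : Fin n → C(X, ℂ)} (hm : T.IsFilterBank m) {x y : X}
    (hxy : T x = T y) :
    ∑ i, 1 / (T.fiberCard (T x) : ℂ) * (m i x * conj (m i y)) = if x = y then 1 else 0 := by
  -- A continuous function that is `1` at `y` and `0` at the other points of the fibre.
  obtain ⟨f, hf0, hf1, -⟩ := exists_continuous_zero_one_of_isClosed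
    (s := T ⁻¹' {T x} \ {y}) (t := {y})
    ((T.finite_fiber (T x)).subset sdiff_subset).isClosed isClosed_singleton
    disjoint_sdiff_left
  let ξ : C(X, ℂ) := ⟨fun z => (f z : ℂ), Complex.continuous_ofReal.comp f.continuous⟩
  have hξ : ∀ z, T z = T x → ξ z = if z = y then 1 else 0 := fun z hz => by
    change (f z : ℂ) = _
    split_ifs with h
    · rw [hf1 h]
      simp
    · rw [hf0 ⟨hz, h⟩]
      simp
  have hin (i : Fin n) :
      T.deaconuInner (m i) ξ (T x) = 1 / (T.fiberCard (T x) : ℂ) * conj (m i y) := by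
    change 1 / (T.fiberCard (T x) : ℂ) * ∑ᶠ z ∈ T ⁻¹' {T x}, conj (m i z) * ξ z = _
    rw [finsum_mem_eq_finite_toFinset_sum _ (T.finite_fiber (T x)),
      Finset.sum_eq_single_of_mem y (by simpa using hxy.symm)]
    · rw [hξ y hxy.symm, if_pos rfl, mul_one]
    · intro z hz hzy
      rw [hξ z (by simpa using hz), if_neg hzy, mul_zero]
  have h := congrArg (fun g : C(X, ℂ) => g x) (hm.eq_sum ξ)
  simp only [ContinuousMap.sum_apply] at h
  rw [← hξ x rfl, h]
  refine Finset.sum_congr rfl fun i _ => ?_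
  change _ = m i x * T.deaconuInner (m i) ξ (T x)
  rw [hin]
  ring

/-! ### The relations in the groupoid algebra -/

lemma iota_mul (a b : C(X, ℂ)) : T.iota (a * b) = T.iota a * T.iota b :=
  (congrArg (CStarG.of T) (map_mul T.iotaHom a b)).trans (CStarG.of_mul _ _)

lemma iota_one : T.iota 1 = 1 := rfl

lemma iota_zero : T.iota 0 = 0 :=
  (congrArg (CStarG.of T) (map_zero T.iotaHom)).trans UniformSpace.Completion.coe_zero

lemma iota_beta_mul_S (a : C(X, ℂ)) : T.iota (T.beta a) * T.S = T.S * T.iota a := by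
  rw [iota, iota, S, ← CStarG.of_mul, ← CStarG.of_mul]
  congr 1
  classical
  refine ConvAlg.ext_val fun x n y _ => ?_
  rw [val_iotaFun_mul, val_mul_iotaFun, val_isoFun]
  split_ifs with h
  · obtain ⟨-, rfl⟩ := h
    exact mul_comm _ _
  · rw [mul_zero, zero_mul]

lemma iota_beta_mul_psi (a ξ : C(X, ℂ)) :
    T.iota (T.beta a) * T.psi ξ = T.psi ξ * T.iota a := by
  rw [psi, ← mul_assoc, ← iota_mul, mul_comm (T.beta a), iota_mul, mul_assoc, iota_beta_mul_S,
    mul_assoc]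

lemma star_psi_mul_psi (ξ η : C(X, ℂ)) :
    star (T.psi ξ) * T.psi η = T.iota (T.deaconuInner ξ η) := by
  rw [psi_eq_of, psi_eq_of, CStarG.star_of, ← CStarG.of_mul, star_psiFun_mul_psiFun, iota]

lemma IsFilterBank.sum_psi_mul_star_psi {n : ℕ} {m : Fin n → C(X, ℂ)} (hm : T.IsFilterBank m) :
    ∑ i, T.psi (m i) * star (T.psi (m i)) = 1 := by
  classical
  simp_rw [psi_eq_of, CStarG.star_of, ← CStarG.of_mul]
  rw [← CStarG.of_one]
  refine (map_sum (AddMonoidHom.mk' (CStarG.of T) CStarG.of_add) _ _).symm.trans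
    (congrArg (CStarG.of T) (ConvAlg.ext_val fun x n y _ => ?_))
  let ev : T.ConvAlg →+ ℂ := AddMonoidHom.mk' (fun f => f.val x n y) fun f g => f.val_add g x n y
  refine (map_sum ev _ _).trans ?_
  change ∑ i, (T.psiFun (m i) * star (T.psiFun (m i))).val x n y = _
  simp_rw [val_psiFun_mul_star_psiFun]
  rw [ConvAlg.one_def, val_iotaFun]
  by_cases h : n = 0 ∧ T x = T y
  · simp_rw [if_pos h]
    rw [hm.sum_mul_conj h.2]
    simp [h.1]
  · simp_rw [if_neg h]
    rw [Finset.sum_const_zero, if_neg]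
    rintro ⟨rfl, rfl⟩
    exact h ⟨rfl, rfl⟩

lemma IsFilterBank.isCuntzFamily {n : ℕ} {m : Fin n → C(X, ℂ)} (hm : T.IsFilterBank m) :
    IsCuntzFamily fun i => T.psi (m i) where
  star_mul i j := by
    rw [star_psi_mul_psi, hm.orthonormal]
    split_ifs
    · exact iota_one
    · exact iota_zero
  sum_mul_star := hm.sum_psi_mul_star_psi

end SurjLocalHomeo

theorem theorem4 {X : Type u} [TopologicalSpace X] [CompactSpace X] [T2Space X]
    (T : SurjLocalHomeo X) :
    (∀ a : C(X, ℂ), T.iota (T.beta a) * T.S = T.S * T.iota a) ∧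
    ∀ (n : ℕ) (m : Fin n → C(X, ℂ)), T.IsFilterBank m →
      IsCuntzFamily (fun i => T.psi (m i)) ∧
      (∀ (a : C(X, ℂ)) (i : Fin n),
        T.iota (T.beta a) * T.psi (m i) = T.psi (m i) * T.iota a) ∧
      ∀ a : C(X, ℂ),
        T.iota (T.beta a) = ∑ i, T.psi (m i) * T.iota a * star (T.psi (m i)) := by
  refine ⟨SurjLocalHomeo.iota_beta_mul_S, fun n m hm => ⟨hm.isCuntzFamily,
    fun a i => SurjLocalHomeo.iota_beta_mul_psi a (m i), fun a => ?_⟩⟩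
  simp_rw [← SurjLocalHomeo.iota_beta_mul_psi, mul_assoc]
  rw [← Finset.mul_sum, hm.sum_psi_mul_star_psi, mul_one]
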